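/- All graphs are finite and simple; $\Delta(G)$ is the maximum degree and $\chi$ the chromatic number. The square $G^2$ of a graph $G$ has the vertex set of $G$, and two distinct vertices are adjacent in $G^2$ if and only if they are adjacent in $G$ or have a common neighbour in $G$. A graph is outerplanar if it can be drawn in the plane without crossings, in a closed disc with all of its vertices on the bounding circle (equivalently, with all vertices on the boundary of the unbounded face). A graph is biconnected if it is connected and has no cutvertex. A minimal criminal is a biconnected outerplanar graph $G$ with $\Delta(G)=6$ and $\chi(G^2)=8$ that has the minimum number of vertices among all graphs with these properties. **Theorem.** There is no minimal criminal: every biconnected outerplanar graph $G$ with $\Delta(G)=6$ satisfies $\chi(G^2)=\Delta(G)+1=7$. Moreover, every outerplanar graph $G$ with $\Delta(G)=6$, biconnected or not, satisfies $\chi(G^2)=7$. -/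

import Mathlib

universe u

/-- The square `G²` of a graph: distinct vertices are adjacent when they are adjacent in `G` or
have a common neighbour in `G`. -/
def squareGraph {V : Type u} (G : SimpleGraph V) : SimpleGraph V where
  Adj a b := a ≠ b ∧ (G.Adj a b ∨ ∃ w, G.Adj a w ∧ G.Adj w b)
  symm := ⟨by
    rintro a b ⟨hne, h | ⟨w, haw, hwb⟩⟩
    · exact ⟨hne.symm, Or.inl h.symm⟩
    · exact ⟨hne.symm, Or.inr ⟨w, hwb.symm, haw.symm⟩⟩⟩
  loopless := ⟨fun _ h => h.1 rfl⟩

/-- `A` is a simple (Jordan) arc in the plane with end points `x` and `y`. -/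
def IsSimpleArc (A : Set ℂ) (x y : ℂ) : Prop :=
  ∃ γ : Path x y, Function.Injective γ ∧ Set.range γ = A

/-- A crossing-free drawing of `G` in the closed unit disc with all vertices on the bounding
circle (so that all of them lie on the boundary of the unbounded face): the vertex `v` is the
point `p v`, and the edge `e` is the simple arc `A e` joining the two ends of `e`. -/
structure IsOuterplanarDrawing {V : Type u} (G : SimpleGraph V) (p : V → ℂ)
    (A : Sym2 V → Set ℂ) : Prop where
  injective : Function.Injective p
  on_circle : ∀ v, p v ∈ Metric.sphere (0 : ℂ) 1
  arc : ∀ v w, G.Adj v w → IsSimpleArc (A s(v, w)) (p v) (p w)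
  in_disc : ∀ e ∈ G.edgeSet, A e ⊆ Metric.closedBall (0 : ℂ) 1
  /-- An edge passes through no vertex other than its two ends. -/
  vertex_mem : ∀ e ∈ G.edgeSet, ∀ v, p v ∈ A e → v ∈ e
  /-- Two different edges meet at most in a common end. -/
  edge_inter : ∀ e ∈ G.edgeSet, ∀ f ∈ G.edgeSet, e ≠ f →
    A e ∩ A f ⊆ p '' {v | v ∈ e ∧ v ∈ f}

/-- A graph is outerplanar if it has a plane drawing without crossings, inside a closed disc,
whose vertices all lie on the boundary of the disc. -/
def IsOuterplanar {V : Type u} (G : SimpleGraph V) : Prop :=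
  ∃ (p : V → ℂ) (A : Sym2 V → Set ℂ), IsOuterplanarDrawing G p A

/-- Biconnected: connected, and still connected after the deletion of any one vertex
(that is, connected without cutvertices). -/
def IsBiconnected {V : Type u} (G : SimpleGraph V) : Prop :=
  G.Connected ∧ ∀ v : V, (G.induce {v}ᶜ).Preconnected

/-- A criminal: a biconnected outerplanar graph `G` of maximum degree `6` with `χ(G²) = 8`. -/
def IsCriminal {V : Type u} [Fintype V] (G : SimpleGraph V) [DecidableRel G.Adj] : Prop :=
  IsBiconnected G ∧ IsOuterplanar G ∧ G.maxDegree = 6 ∧ (squareGraph G).chromaticNumber = 8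

/-- A minimal criminal: a criminal with the minimum number of vertices. -/
def IsMinimalCriminal {V : Type u} [Fintype V] (G : SimpleGraph V) [DecidableRel G.Adj] : Prop :=
  IsCriminal G ∧
    ∀ (W : Type u) [Fintype W] (H : SimpleGraph W) [DecidableRel H.Adj],
      IsCriminal H → Fintype.card V ≤ Fintype.card W

/-! The lower bound is the clique formed by a vertex of maximum degree and its neighbours. For the
upper bound, cutting the circle open orders the vertices on a line so that no two edges cross, and
the square is coloured interval by interval. For an interval with ends `u < v` the boundary data are
the colours `x`, `y` of the ends and the sets `R`, `L` of colours permitted on their neighbours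
inside. Up to permuting the seven colours, and for given sizes of `R` and `L`, the data are
determined by whether `x = y`, `x ∈ L`, `y ∈ R`, and by `|R ∩ L|`: 35 types (`exists_perm_pair`).

By induction on length (`exists_hasKind`), every interval is an edge piece, a chain or a free piece.
For all sizes of `R` and `L` at least the degrees inside, each kind guarantees that one of a few
listed sets of types consists of colourable data. A nonadjacent interval is cut at the farthest
neighbour of `u`, or just after `u` if there is none; an adjacent one is treated by deleting `uv`
and restoring it. That the lists are closed under these operations is a finite computation
(`glueCheck_edge` and its companions, `closeCheck`). With all six other colours permitted at both
ends, every kind allows a colouring. -/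

/-! ### Crossing of curves with interlaced ends in the disc -/

open Complex in
theorem arg_one_sub_exp {x : ℝ} (h0 : 0 < x) (h1 : x < 2 * Real.pi) :
    arg (1 - exp (x * I)) = (x - Real.pi) / 2 := by
  have hs : 0 < Real.sin (x / 2) := Real.sin_pos_of_pos_of_lt_pi (by linarith) (by linarith)
  have hc : Real.cos ((x - Real.pi) / 2) = Real.sin (x / 2) := by
    rw [← Real.cos_sub_pi_div_two]; congr 1; ring
  have hs' : Real.sin ((x - Real.pi) / 2) = -Real.cos (x / 2) := by
    rw [← Real.sin_sub_pi_div_two]; congr 1; ring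
  -- Polar form: the modulus is `2 sin (x/2) > 0` and the angle `(x - π)/2` lies in the principal
  -- range.
  have e : 1 - exp (x * I) = ((2 * Real.sin (x / 2) : ℝ) : ℂ) *
      (cos (((x - Real.pi) / 2 : ℝ) : ℂ) + sin (((x - Real.pi) / 2 : ℝ) : ℂ) * I) := by
    rw [← ofReal_cos, ← ofReal_sin, hc, hs', exp_mul_I, ← ofReal_cos, ← ofReal_sin]
    have h2 : Real.cos x = 1 - 2 * Real.sin (x / 2) ^ 2 := by
      have := Real.cos_two_mul (x / 2)
      rw [Real.cos_sq'] at this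
      rw [show x = 2 * (x / 2) by ring, this]; ring_nf
    have h3 : Real.sin x = 2 * Real.sin (x / 2) * Real.cos (x / 2) := by
      rw [← Real.sin_two_mul]; congr 1; ring
    rw [h2, h3]
    push_cast
    ring
  rw [e, arg_mul_cos_add_sin_mul_I (by linarith) ⟨by linarith, by linarith⟩]

open Complex in
theorem arg_one_sub_exp_of_neg {x : ℝ} (h0 : x < 0) (h1 : -(2 * Real.pi) < x) :
    arg (1 - exp (x * I)) = (x + Real.pi) / 2 := by
  have h := arg_one_sub_exp (x := -x) (by linarith) (by linarith)
  have e : 1 - exp (x * I) = (starRingEnd ℂ) (1 - exp ((-x : ℝ) * I)) := by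
    simp [← exp_conj]
  rw [e, arg_conj, h, if_neg (by linarith)]
  ring

open Complex in
/-- If `z` moves in the closed unit disc, the variation of the argument of `p - z`, with `p` on the
unit circle, is computed by the principal branch. -/
theorem angle_variation {p : ℂ} (hp : ‖p‖ = 1) {z : ℝ → ℂ} (hz : Continuous z)
    (hz1 : ∀ t, ‖z t‖ ≤ 1) (hzp : ∀ t, z t ≠ p) {θ : ℝ → ℝ} (hθ : Continuous θ)
    (h : ∀ t, p - z t = ‖p - z t‖ * exp (θ t * I)) (s t : ℝ) :
    θ t - θ s = arg (1 - z t / p) - arg (1 - z s / p) := by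
  have hp0 : p ≠ 0 := by rintro rfl; simp at hp
  -- After rotating `p` to 1, the difference stays in the open right half-plane, where `arg` is
  -- continuous.
  have hre : ∀ t, 0 < (1 - z t / p).re := by
    intro t
    have h1 : ‖z t / p‖ ≤ 1 := by rw [norm_div, hp, div_one]; exact hz1 t
    have h2 : (z t / p).re ≤ 1 := (re_le_norm _).trans h1
    rcases h2.lt_or_eq with h3 | h3
    · simpa using h3
    · exfalso
      have h4 : (z t / p).im = 0 := by
        have := Complex.normSq_eq_norm_sq (z t / p)
        rw [normSq_apply, h3] at this
        nlinarith [norm_nonneg (z t / p)]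
      have h5 : z t / p = 1 := Complex.ext h3 h4
      exact hzp t ((div_eq_one_iff_eq hp0).1 h5)
  have hcont : Continuous fun t => θ t - arg (1 - z t / p) :=
    hθ.sub (continuous_iff_continuousAt.2 fun t =>
      (continuousAt_arg (Or.inl (hre t))).comp (f := fun t => 1 - z t / p) (by fun_prop))
  have hexp : ∀ t, exp ((θ t - arg (1 - z t / p) : ℝ) * I) = p := by
    intro t
    have hne : p - z t ≠ 0 := sub_ne_zero.2 (hzp t).symm
    have e1 : p - z t = p * (1 - z t / p) := by field_simp
    have e2 := norm_mul_exp_arg_mul_I (1 - z t / p)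
    have e3 : ‖p - z t‖ = ‖1 - z t / p‖ := by rw [e1, norm_mul, hp, one_mul]
    have hn : (‖1 - z t / p‖ : ℂ) ≠ 0 := by
      rw [← e3]; exact_mod_cast norm_ne_zero_iff.2 hne
    have e4 : (‖1 - z t / p‖ : ℂ) * exp (θ t * I) =
        p * ((‖1 - z t / p‖ : ℂ) * exp (arg (1 - z t / p) * I)) := by
      rw [e2, ← e1, ← e3]; exact (h t).symm
    have e5 : exp (θ t * I) = p * exp (arg (1 - z t / p) * I) :=
      mul_left_cancel₀ hn (by rw [e4]; ring)
    push_cast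
    rw [sub_mul, exp_sub, e5]
    field_simp
  have := Circle.isCoveringMap_exp.eq_of_comp_eq hcont (continuous_const (y := θ s - arg (1 - z s / p)))
    (by ext t; simp only [Function.comp, Circle.coe_exp]; rw [hexp, hexp]) s rfl
  have := congrFun this t
  linarith

open Complex in
/-- Two curves in the closed unit disc with interlaced ends on the unit circle meet. -/
theorem exists_eq_of_interlaced {α β γ δ : ℝ} (h1 : α < β) (h2 : β < γ) (h3 : γ < δ)
    (h4 : δ < α + 2 * Real.pi) (f : Path (exp (α * I)) (exp (γ * I)))
    (g : Path (exp (β * I)) (exp (δ * I))) (hf : ∀ t, ‖f t‖ ≤ 1) (hg : ∀ t, ‖g t‖ ≤ 1) :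
    ∃ s t, f s = g t := by
  by_contra! hne
  have hne' : ∀ s t : ℝ, f.extend s ≠ g.extend t := fun s t => hne _ _
  have hf' : ∀ t : ℝ, ‖f.extend t‖ ≤ 1 := fun t => hf _
  have hg' : ∀ t : ℝ, ‖g.extend t‖ ≤ 1 := fun t => hg _
  have hF : ∀ q : ℝ × ℝ, ‖f.extend q.1 - g.extend q.2‖ ≠ 0 := fun q =>
    norm_ne_zero_iff.2 (sub_ne_zero.2 (hne' _ _))
  -- If the curves were disjoint, the direction of `f s - g t` would lift to a continuous angle on
  -- the plane. Its variations along the two routes from (0,0) to (1,1) differ by `2π`, a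
  -- contradiction.
  let u : C(ℝ × ℝ, Circle) :=
    ⟨fun q => ⟨(f.extend q.1 - g.extend q.2) / ‖f.extend q.1 - g.extend q.2‖, by
      rw [Submonoid.unitSphere, ← SetLike.mem_coe]
      simp [hF q]⟩, by
      refine Continuous.subtype_mk (Continuous.div (by fun_prop) (by fun_prop) fun q => ?_) _
      exact_mod_cast hF q⟩
  obtain ⟨θ₀, hθ₀⟩ := Circle.exp_surjective (u (0, 0))
  obtain ⟨θ, ⟨-, hθ⟩, -⟩ := Circle.isCoveringMap_exp.existsUnique_continuousMap_lifts u (0, 0) θ₀ hθ₀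
  have key : ∀ s t : ℝ, f.extend s - g.extend t =
      ‖f.extend s - g.extend t‖ * exp (θ (s, t) * I) := by
    intro s t
    have := congrArg Subtype.val (congrFun hθ (s, t))
    simp only [Function.comp, Circle.coe_exp] at this
    have hn : (‖f.extend s - g.extend t‖ : ℂ) ≠ 0 := by exact_mod_cast hF (s, t)
    rw [this]
    change _ = (‖f.extend s - g.extend t‖ : ℂ) *
      ((f.extend s - g.extend t) / (‖f.extend s - g.extend t‖ : ℂ))
    field_simp
  have key' : ∀ s t : ℝ, g.extend t - f.extend s =
      ‖g.extend t - f.extend s‖ * exp ((θ (s, t) + Real.pi : ℝ) * I) := by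
    intro s t
    push_cast
    rw [add_mul, exp_add, exp_pi_mul_I, norm_sub_rev, ← neg_sub, key s t]
    simp
  have quot : ∀ x y : ℝ, 1 - exp (x * I) / exp (y * I) = 1 - exp ((x - y : ℝ) * I) := by
    intro x y; push_cast; rw [sub_mul, exp_sub]
  have s0 := angle_variation (p := f.extend 0) (by simp [norm_exp_ofReal_mul_I]) g.continuous_extend hg'
    (fun t => (hne' 0 t).symm) (θ := fun t => θ (0, t)) (by fun_prop) (fun t => key 0 t) 0 1
  have s1 := angle_variation (p := f.extend 1) (by simp [norm_exp_ofReal_mul_I]) g.continuous_extend hg'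
    (fun t => (hne' 1 t).symm) (θ := fun t => θ (1, t)) (by fun_prop) (fun t => key 1 t) 0 1
  have t0 := angle_variation (p := g.extend 0) (by simp [norm_exp_ofReal_mul_I]) f.continuous_extend hf'
    (fun s => hne' s 0) (θ := fun s => θ (s, 0) + Real.pi) (by fun_prop) (fun s => key' s 0) 0 1
  have t1 := angle_variation (p := g.extend 1) (by simp [norm_exp_ofReal_mul_I]) f.continuous_extend hf'
    (fun s => hne' s 1) (θ := fun s => θ (s, 1) + Real.pi) (by fun_prop) (fun s => key' s 1) 0 1
  simp only [Path.extend_zero, Path.extend_one, quot] at s0 s1 t0 t1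
  rw [arg_one_sub_exp (by linarith) (by linarith), arg_one_sub_exp (by linarith) (by linarith)] at s0
  rw [arg_one_sub_exp (by linarith) (by linarith),
    arg_one_sub_exp_of_neg (by linarith) (by linarith)] at s1 t0
  rw [arg_one_sub_exp_of_neg (by linarith) (by linarith),
    arg_one_sub_exp_of_neg (by linarith) (by linarith)] at t1
  linarith [Real.pi_pos]

/-! ### Types of boundary data and the finite checks -/

/-- Number of elements of the colour set coded by the lowest seven binary digits of `n`. -/
def bitCard (n : ℕ) : ℕ :=
  n % 2 + n / 2 % 2 + n / 4 % 2 + n / 8 % 2 + n / 16 % 2 + n / 32 % 2 + n / 64 % 2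

/-- Binary version of `pairType`. -/
def bitType (x R y L : ℕ) : ℕ :=
  bif x == y then bitCard (Nat.land R L)
  else 7 * (1 + Nat.shiftRight L x % 2 + 2 * (Nat.shiftRight R y % 2)) + bitCard (Nat.land R L)

/-- The three kinds of pieces between two vertices `u < v`: those with the edge `uv`, chains of
such pieces, and pieces allowing every combination of boundary colours. -/
inductive PieceKind
  | edge
  | chain
  | free

/-- The sets of types (coded in binary) guaranteed for a chain whose ends have `a` and `b`
admissible colours for their neighbours. -/
def chainTypes (a b : ℕ) : List ℕ :=
  -- Bit `t` of a mask stands for type `t`; two masks in an entry are alternatives. The table is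
  -- justified only by the checks `glueCheck_edge` and `closeCheck`. Sizes 0 do not arise for
  -- chains, whose ends both have a neighbour inside.
  (([[[256, 129], [256, 16513], [33024], [33024], [33024], [32768]],
    [[2097281, 256], [256], [33536], [99072], [98816], [65536]],
    [[4194560], [4195072], [549553920], [1623426560], [1619198976], [1073872896]],
    [[4194560], [12583680], [1640072704], [3783461888], [3238397952], [2147745792]],
    [[4194560], [12583424], [1635845120], [3271690240], [6476271616], [4295491584]],
    [[4194304], [8388608], [1090519040], [2181038080], [4362076160], [8589934592]]].getD
      (a - 1) []).getD (b - 1) [])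

/-- The types for which the neighbours of the two (adjacent) ends share at least `lo` and at most
`hi` colours. -/
def edgeRange (lo hi : ℕ) : ℕ :=
  2 ^ 28 * (2 ^ (hi + 1) - 2 ^ lo)

/-- The sets of types guaranteed for a piece with an edge between its ends. -/
def edgeTypes (a b : ℕ) : List ℕ :=
  -- Across an edge `x ∈ L` and `y ∈ R`, so only types `28 + k` with `k = |R ∩ L|` matter. Here `k ≤
  -- min a b - 1`, since `y ∈ R \ L` and `x ∈ L \ R`, and `k ≥ a + b - 7`. In the last case only `k
  -- = 0` is given up.
  bif a == 1 || b == 1 then [edgeRange 0 0]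
  else bif Nat.ble (a + b) (5) then [edgeRange 0 0, edgeRange 1 1]
  else bif a == 3 && b == 3 then [edgeRange 1 1]
  else [edgeRange (max 1 (a + b - 7)) (min a b - 1)]

/-- The possible sets of types guaranteed for a piece, one of which is available; `a` and `b` are
the numbers of colours admitted on the neighbours of its ends. -/
def PieceKind.types : PieceKind → ℕ → ℕ → List ℕ
  | .edge, a, b => edgeTypes a b
  | .chain, a, b => chainTypes a b
  | .free, _, _ => [2 ^ 35 - 1]

/-- Whether a pair type `c` is possible for colour sets of sizes `a` and `b`. -/
def feasible (a b c : ℕ) : Bool :=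
  bif c / 7 == 0 then Nat.ble (c) (a) && Nat.ble (c) (b) && Nat.ble (a + b) (6 + c)
  else
    let k := c % 7
    let q := (c / 7 - 1) / 2
    let p := (c / 7 - 1) % 2
    Nat.ble (q + k) (a) && Nat.ble (p + k) (b) && Nat.ble (a + b) (5 + k + p + q)

/-- The colour `y` in the standard data `(0, R, y, L)` of type `c`. -/
def stdY (c : ℕ) : ℕ := bif c / 7 == 0 then 0 else 1

/-- The set `R` of size `a` in the standard data `(0, R, y, L)` of type `c`. -/
def stdR (a c : ℕ) : ℕ :=
  bif c / 7 == 0 then 2 * (2 ^ a - 1)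
  else 2 * ((c / 7 - 1) / 2) + 4 * (2 ^ (a - (c / 7 - 1) / 2) - 1)

/-- The set `L` of size `b` in the standard data `(0, R, y, L)` of type `c`. -/
def stdL (a b c : ℕ) : ℕ :=
  -- Apart from the end colours, `R` and `L` are blocks of consecutive colours; the block of `L`
  -- starts so that it overlaps the block of `R` in exactly the required number of colours.
  bif c / 7 == 0 then 2 ^ (1 + a - c) * (2 ^ b - 1)
  else (c / 7 - 1) % 2 +
    2 ^ (2 + a - (c / 7 - 1) / 2 - c % 7) * (2 ^ (b - (c / 7 - 1) % 2) - 1)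

/-- The colour sets with `b` elements. -/
def bitSets : ℕ → List ℕ
  | 0 => [0]
  | 1 => [1, 2, 4, 8, 16, 32, 64]
  | 2 => [3, 5, 6, 9, 10, 12, 17, 18, 20, 24, 33, 34, 36, 40, 48, 65, 66, 68, 72, 80, 96]
  | 3 => [7, 11, 13, 14, 19, 21, 22, 25, 26, 28, 35, 37, 38, 41, 42, 44, 49, 50, 52, 56, 67, 69,
      70, 73, 74, 76, 81, 82, 84, 88, 97, 98, 100, 104, 112]
  | 4 => [15, 23, 27, 29, 30, 39, 43, 45, 46, 51, 53, 54, 57, 58, 60, 71, 75, 77, 78, 83, 85, 86,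
      89, 90, 92, 99, 101, 102, 105, 106, 108, 113, 114, 116, 120]
  | 5 => [31, 47, 55, 59, 61, 62, 79, 87, 91, 93, 94, 103, 107, 109, 110, 115, 117, 118, 121, 122,
      124]
  | 6 => [63, 95, 111, 119, 123, 125, 126]
  | _ => []

/-- Whether there are a colour `w` and a set `S` of `b` other colours at which the types `m₁` on
the left and `m₂` on the right can be glued, the right piece using the colours off `S` and `w`. -/
def canGlue (b m₁ m₂ x R y L : ℕ) : Bool :=
  (bitSets b).any fun S => (List.range 7).any fun w =>
    Nat.testBit m₁ (bitType x R w S) && (Nat.shiftRight S w % 2 == 0 &&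
      Nat.testBit m₂ (bitType w (127 - S - 2 ^ w) y L))

/-- Gluing pieces of the kinds `k₁` and `k₂`, with `b` colours on the left of the common vertex and
`6 - b` on its right, gives a piece of the kind `k₃`. -/
def glueCheck (k₁ k₂ k₃ : PieceKind) (a b c : ℕ) : Bool :=
  (k₁.types a b).all fun m₁ => (k₂.types (6 - b) c).all fun m₂ => (k₃.types a c).any fun m₃ =>
    (List.range 35).all fun t => !(Nat.testBit m₃ t && feasible a c t) ||
      canGlue b m₁ m₂ 0 (stdR a t) (stdY t) (stdL a c t)

/-- Here `1 ≤ b ≤ 5`, because the cut vertex has a neighbour on each side and at most six in all. -/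
theorem glueCheck_edge : ∀ (a : Fin 6) (b : Fin 5) (c : Fin 6),
    glueCheck .edge .edge .chain (a + 1) (b + 1) (c + 1) = true ∧
      glueCheck .edge .chain .chain (a + 1) (b + 1) (c + 1) = true := by
  decide +kernel

/-- The value `b = 6` is included: a free piece may contain no neighbour of the cut vertex. -/
theorem glueCheck_edge_free : ∀ (a b : Fin 6) (c : Fin 7),
    glueCheck .edge .free .free (a + 1) (b + 1) c = true := by
  decide +kernel

/-- The left piece is a gap between consecutive nonadjacent vertices, hence `b = 0`. -/
theorem glueCheck_free_left : ∀ (a : Fin 7) (c : Fin 6),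
    glueCheck .free .edge .free a 0 (c + 1) = true ∧
      glueCheck .free .chain .free a 0 (c + 1) = true := by
  decide +kernel

theorem glueCheck_free : ∀ a c : Fin 7, glueCheck .free .free .free a 0 c = true := by
  decide +kernel

/-! ### Boundary data up to permutation of the colours -/

/-- The type of two (not necessarily distinct) vertices with colours `x` and `y` whose neighbours
have their colours in `R` and in `L`. -/
def pairType (x : Fin 7) (R : Finset (Fin 7)) (y : Fin 7) (L : Finset (Fin 7)) : ℕ :=
  (if x = y then 0 else 7 * (1 + (if x ∈ L then 1 else 0) + (if y ∈ R then 2 else 0))) +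
    (R ∩ L).card

/-- The colour set coded by a number. -/
def bitSet (n : ℕ) : Finset (Fin 7) :=
  Finset.univ.filter fun i => n.testBit i

theorem mem_bitSet {n : ℕ} {i : Fin 7} : i ∈ bitSet n ↔ n.testBit i := by
  simp [bitSet]

theorem card_bitSet (n : ℕ) : (bitSet n).card = bitCard n := by
  simp only [bitSet, bitCard, Finset.card_filter, Fin.sum_univ_succ, Nat.testBit_eq_decide_div_mod_eq]
  have h : ∀ m : ℕ, (if m % 2 = 1 then 1 else 0) = m % 2 := by intro m; split <;> omega
  simp [h]
  ring

theorem bitSet_inter (m n : ℕ) : bitSet m ∩ bitSet n = bitSet (Nat.land m n) := by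
  ext i
  simp [mem_bitSet]

theorem bitType_eq (x y : Fin 7) (R L : ℕ) :
    bitType x R y L = pairType x (bitSet R) y (bitSet L) := by
  have h : ∀ (m : ℕ) (i : Fin 7), Nat.shiftRight m i % 2 = if i ∈ bitSet m then 1 else 0 := by
    intro m i
    have : Nat.shiftRight m i = m / 2 ^ (i : ℕ) := Nat.shiftRight_eq_div_pow m i
    simp only [this, mem_bitSet, Nat.testBit_eq_decide_div_mod_eq, decide_eq_true_eq]
    split <;> omega
  unfold bitType pairType
  rw [h, h, bitSet_inter, card_bitSet]
  by_cases hxy : x = y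
  · simp [hxy]
  · have : ((x : ℕ) == (y : ℕ)) = false := by simpa [Fin.ext_iff] using hxy
    rw [this]
    simp only [hxy, cond_false, if_false]
    congr 2
    split <;> split <;> rfl

theorem bitSet_compl : ∀ (S : Fin 128) (w : Fin 7), w ∉ bitSet S →
    bitSet (127 - S - 2 ^ (w : ℕ)) = (insert w (bitSet S))ᶜ := by
  decide +kernel

theorem bitSets_spec : ∀ b : Fin 7, ∀ S ∈ bitSets b, S < 128 ∧ bitCard S = b := by
  decide +kernel

/-- Two functions on a finite type with equally large fibres differ by a permutation. -/
theorem exists_perm_of_card_fiber_eq {α β : Type*} [Fintype α] [DecidableEq α] [DecidableEq β]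
    (f g : α → β) (h : ∀ t, (Finset.univ.filter fun i => f i = t).card =
      (Finset.univ.filter fun i => g i = t).card) :
    ∃ σ : Equiv.Perm α, ∀ i, g (σ i) = f i := by
  have e : ∀ t, Nonempty ({i // f i = t} ≃ {i // g i = t}) := fun t =>
    ⟨Fintype.equivOfCardEq (by rw [Fintype.card_subtype, Fintype.card_subtype, h])⟩
  exact ⟨Equiv.ofFiberEquiv fun t => (e t).some, fun i => Equiv.ofFiberEquiv_map _ i⟩

section
variable {x y : Fin 7} {R L : Finset (Fin 7)}

/-- The position of a colour with respect to the data of a pair of vertices. -/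
def colourCell (x : Fin 7) (R : Finset (Fin 7)) (y : Fin 7) (L : Finset (Fin 7)) (i : Fin 7) :
    Bool × Bool × Bool × Bool :=
  (decide (i = x), decide (i = y), decide (i ∈ R), decide (i ∈ L))

/-- The cells of `x` and `y` are singletons and the rest follows by inclusion-exclusion. The point
is that the right-hand side depends only on `|R|`, `|L|` and the information in the type. -/
theorem card_colourCell (hx : x ∉ R) (hy : y ∉ L) (t : Bool × Bool × Bool × Bool) :
    (Finset.univ.filter fun i => colourCell x R y L i = t).card =
      match t with
      | (true, t₂, t₃, t₄) => if t₂ = decide (x = y) ∧ t₃ = false ∧ t₄ = decide (x ∈ L) then 1 else 0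
      | (false, true, t₃, t₄) => if x ≠ y ∧ t₃ = decide (y ∈ R) ∧ t₄ = false then 1 else 0
      | (false, false, true, true) => (R ∩ L).card
      | (false, false, true, false) => R.card - (R ∩ L).card - if y ∈ R then 1 else 0
      | (false, false, false, true) => L.card - (R ∩ L).card - if x ∈ L then 1 else 0
      | (false, false, false, false) => 7 - (R.card + L.card - (R ∩ L).card) -
          if x = y then 1 else 2 - (if x ∈ L then 1 else 0) - if y ∈ R then 1 else 0 := by
  match t with
  | (true, t₂, t₃, t₄) =>
    dsimp only
    split_ifs with h
    · rw [Finset.card_eq_one]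
      refine ⟨x, ?_⟩
      ext i
      simp only [colourCell, Finset.mem_filter, Finset.mem_univ, true_and, Prod.mk.injEq,
        Finset.mem_singleton, decide_eq_true_eq]
      refine ⟨fun h' => h'.1, ?_⟩
      rintro rfl
      simp [h, hx]
    · rw [Finset.card_eq_zero, Finset.filter_eq_empty_iff]
      intro i _ h'
      simp only [colourCell, Prod.mk.injEq, decide_eq_true_eq] at h'
      obtain ⟨rfl, h1, h2, h3⟩ := h'
      exact h ⟨h1.symm, by simp [← h2, hx], h3.symm⟩
  | (false, true, t₃, t₄) =>
    dsimp only
    split_ifs with h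
    · rw [Finset.card_eq_one]
      refine ⟨y, ?_⟩
      ext i
      simp only [colourCell, Finset.mem_filter, Finset.mem_univ, true_and, Prod.mk.injEq,
        Finset.mem_singleton, decide_eq_true_eq]
      refine ⟨fun h' => h'.2.1, ?_⟩
      rintro rfl
      simp [h, hy, Ne.symm h.1]
    · rw [Finset.card_eq_zero, Finset.filter_eq_empty_iff]
      intro i _ h'
      simp only [colourCell, Prod.mk.injEq, decide_eq_true_eq, decide_eq_false_iff_not] at h'
      obtain ⟨h0, rfl, h2, h3⟩ := h'
      exact h ⟨fun e => h0 e.symm, h2.symm, by simp [← h3, hy]⟩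
  | (false, false, true, true) =>
    congr 1
    ext i
    simp only [colourCell, Finset.mem_filter, Finset.mem_univ, true_and, Prod.mk.injEq,
      Finset.mem_inter, decide_eq_true_eq, decide_eq_false_iff_not]
    refine ⟨fun h => h.2.2, fun h => ⟨?_, ?_, h⟩⟩
    · rintro rfl; exact hx h.1
    · rintro rfl; exact hy h.2
  | (false, false, true, false) =>
    have : (Finset.univ.filter fun i => colourCell x R y L i = (false, false, true, false)) =
        (R \ L).erase y := by
      ext i
      simp only [colourCell, Finset.mem_filter, Finset.mem_univ, true_and, Prod.mk.injEq,
        Finset.mem_erase, Finset.mem_sdiff, decide_eq_true_eq, decide_eq_false_iff_not]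
      refine ⟨fun h => h.2, fun h => ⟨?_, h⟩⟩
      rintro rfl; exact hx h.2.1
    rw [this, Finset.card_erase_eq_ite, Finset.card_sdiff, Finset.inter_comm L R]
    simp only [Finset.mem_sdiff, hy, not_false_eq_true, and_true]
    split_ifs <;> rfl
  | (false, false, false, true) =>
    have : (Finset.univ.filter fun i => colourCell x R y L i = (false, false, false, true)) =
        (L \ R).erase x := by
      ext i
      simp only [colourCell, Finset.mem_filter, Finset.mem_univ, true_and, Prod.mk.injEq,
        Finset.mem_erase, Finset.mem_sdiff, decide_eq_true_eq, decide_eq_false_iff_not]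
      refine ⟨fun h => ⟨h.1, h.2.2.2, h.2.2.1⟩, fun h => ⟨h.1, ?_, h.2.2, h.2.1⟩⟩
      rintro rfl; exact hy h.2.1
    rw [this, Finset.card_erase_eq_ite, Finset.card_sdiff]
    simp only [Finset.mem_sdiff, hx, not_false_eq_true, and_true]
    split_ifs <;> rfl
  | (false, false, false, false) =>
    have : (Finset.univ.filter fun i => colourCell x R y L i = (false, false, false, false)) =
        (insert x (insert y (R ∪ L)))ᶜ := by
      ext i
      simp [colourCell]
    rw [this, Finset.card_compl, Finset.card_insert_eq_ite, Finset.card_insert_eq_ite,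
      Finset.card_union, Fintype.card_fin]
    simp only [Finset.mem_insert, Finset.mem_union, hx, hy, false_or, or_false]
    by_cases e : x = y
    · subst e; simp [hx, hy]; omega
    · simp only [e, false_or, if_false]
      split_ifs <;> omega

/-- Since `|R ∩ L| < 7`, the type can be decoded; equal types and sizes give equally large cells,
and a permutation matches them. -/
theorem exists_perm_pair {x' y' : Fin 7} {R' L' : Finset (Fin 7)} (hx : x ∉ R) (hy : y ∉ L)
    (hx' : x' ∉ R') (hy' : y' ∉ L') (hR : R.card = R'.card) (hL : L.card = L'.card)
    (h : pairType x R y L = pairType x' R' y' L') :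
    ∃ σ : Equiv.Perm (Fin 7), σ x = x' ∧ σ y = y' ∧ (∀ i, σ i ∈ R' ↔ i ∈ R) ∧
      ∀ i, σ i ∈ L' ↔ i ∈ L := by
  have small : ∀ {x : Fin 7} {R L : Finset (Fin 7)}, x ∉ R → (R ∩ L).card < 7 := by
    intro x R L hx
    have := Finset.card_le_card (Finset.inter_subset_left (s₁ := R) (s₂ := L))
    have h2 := Finset.card_lt_univ_of_notMem hx
    simp at h2
    omega
  have k1 := small (L := L) hx
  have k2 := small (L := L') hx'
  have key : ((x = y ↔ x' = y') ∧ (x ∈ L ↔ x' ∈ L') ∧ (y ∈ R ↔ y' ∈ R')) ∧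
      (R ∩ L).card = (R' ∩ L').card := by
    unfold pairType at h
    by_cases e : x = y <;> by_cases e' : x' = y'
    · subst e e'; simp only [if_true] at h; simp [hx, hy, hx', hy']; omega
    · simp only [e, e', if_true, if_false] at h; omega
    · simp only [e, e', if_true, if_false] at h; omega
    · simp only [e, e', if_false] at h ⊢
      refine ⟨?_, ?_⟩
      · by_cases p : x ∈ L <;> by_cases p' : x' ∈ L' <;> by_cases q : y ∈ R <;>
          by_cases q' : y' ∈ R' <;> simp only [p, p', q, q', if_true, if_false] at h <;>
          first | (exfalso; omega) | simp [p, p', q, q']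
      · split_ifs at h <;> omega
  obtain ⟨⟨e1, e2, e3⟩, e4⟩ := key
  obtain ⟨σ, hσ⟩ := exists_perm_of_card_fiber_eq (colourCell x R y L) (colourCell x' R' y' L') (by
    intro t
    rw [card_colourCell hx hy, card_colourCell hx' hy']
    simp only [e1, e2, e3, e4, hR, hL, ne_eq])
  simp only [colourCell, Prod.mk.injEq, decide_eq_decide] at hσ
  exact ⟨σ, (hσ x).1.2 rfl, (hσ y).2.1.2 rfl, fun i => (hσ i).2.2.1, fun i => (hσ i).2.2.2⟩

end

theorem pairType_lt {x y : Fin 7} {R L : Finset (Fin 7)} (hx : x ∉ R) : pairType x R y L < 35 := by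
  have h1 := Finset.card_le_card (Finset.inter_subset_left (s₁ := R) (s₂ := L))
  have h2 := Finset.card_lt_univ_of_notMem hx
  simp only [Fintype.card_fin] at h2
  unfold pairType
  split_ifs <;> omega

/-- The types skipped by `glueCheck` never occur. For `x ≠ y`, only five colours are left for `R ∪
L` outside `{x, y}`. -/
theorem feasible_pairType {x y : Fin 7} {R L : Finset (Fin 7)} (hx : x ∉ R) (hy : y ∉ L) :
    feasible R.card L.card (pairType x R y L) = true := by
  have hk : (R ∩ L).card < 7 := by
    have h1 := Finset.card_le_card (Finset.inter_subset_left (s₁ := R) (s₂ := L))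
    have h2 := Finset.card_lt_univ_of_notMem hx
    simp only [Fintype.card_fin] at h2
    omega
  have hU := Finset.card_union_add_card_inter R L
  have hK := Finset.card_le_card (Finset.inter_subset_left (s₁ := R) (s₂ := L))
  have hK' := Finset.card_le_card (Finset.inter_subset_right (s₁ := R) (s₂ := L))
  by_cases e : x = y
  · subst e
    have h1 := Finset.card_lt_univ_of_notMem (s := R ∪ L) (x := x) (by simp [hx, hy])
    have h0 : (R ∩ L).card / 7 = 0 := by omega
    simp only [Fintype.card_fin] at h1
    simp only [feasible, pairType, if_true, zero_add, h0, beq_self_eq_true, cond_true,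
      Bool.and_eq_true, Nat.ble_eq]
    omega
  · have hD : ((R ∪ L) \ {x, y}).card + 2 ≤ 7 := by
      have := Finset.card_le_univ ((R ∪ L) \ {x, y} ∪ {x, y})
      rw [Finset.card_union_of_disjoint Finset.sdiff_disjoint, Finset.card_pair e] at this
      simpa using this
    have hD2 : (R ∪ L).card ≤ ((R ∪ L) \ {x, y}).card + ((if x ∈ L then 1 else 0) +
        if y ∈ R then 1 else 0) := by
      have h1 := Finset.card_sdiff_add_card_inter (R ∪ L) {x, y}
      have h2 : ((R ∪ L) ∩ {x, y}).card ≤ (if x ∈ L then 1 else 0) + if y ∈ R then 1 else 0 := by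
        rw [Finset.inter_comm, ← Finset.filter_mem_eq_inter, Finset.filter_insert,
          Finset.filter_singleton]
        simp only [Finset.mem_union, hx, hy, false_or, or_false]
        split_ifs <;> simp [Finset.card_le_two]
      omega
    have hp : x ∈ L → (R ∩ L).card + 1 ≤ L.card := fun h => by
      refine Finset.card_lt_card ⟨Finset.inter_subset_right, fun h' => hx ?_⟩
      exact (Finset.mem_inter.1 (h' h)).1
    have hq : y ∈ R → (R ∩ L).card + 1 ≤ R.card := fun h => by
      refine Finset.card_lt_card ⟨Finset.inter_subset_left, fun h' => hy ?_⟩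
      exact (Finset.mem_inter.1 (h' h)).2
    have key : ∀ p q k : ℕ, p < 2 → q < 2 → k < 7 →
        q + k ≤ R.card → p + k ≤ L.card → R.card + L.card ≤ 5 + k + p + q →
        feasible R.card L.card (7 * (1 + p + 2 * q) + k) = true := by
      intro p q k hp hq hk h1 h2 h3
      have e1 : (7 * (1 + p + 2 * q) + k) / 7 = 1 + p + 2 * q := by omega
      have e2 : (7 * (1 + p + 2 * q) + k) % 7 = k := by omega
      have e3 : (1 + p + 2 * q - 1) / 2 = q := by omega
      have e4 : (1 + p + 2 * q - 1) % 2 = p := by omega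
      have e5 : (1 + p + 2 * q == 0) = false := by simp
      simp only [feasible, e1, e2, e3, e4, e5, cond_false, Bool.and_eq_true, Nat.ble_eq]
      omega
    have := key (if x ∈ L then 1 else 0) (if y ∈ R then 1 else 0) (R ∩ L).card
      (by split_ifs <;> omega) (by split_ifs <;> omega) hk (by split_ifs with h <;> simp_all [add_comm])
      (by split_ifs with h <;> simp_all [add_comm]) (by omega)
    simpa [pairType, e] using this

/-- Makes the standard data a representative of each feasible orbit, so that one check per type
suffices. -/
theorem std_spec : ∀ a c : Fin 7, ∀ t : Fin 35, feasible a c t = true →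
    bitCard (stdR a t) = a ∧ bitCard (stdL a c t) = c ∧ (stdR a t).testBit 0 = false ∧
    (stdL a c t).testBit (stdY t) = false ∧ stdY t < 7 ∧
    bitType 0 (stdR a t) (stdY t) (stdL a c t) = t := by
  decide +kernel

theorem pairType_perm (σ : Equiv.Perm (Fin 7)) (x y : Fin 7) (R L : Finset (Fin 7)) :
    pairType (σ x) (R.map σ.toEmbedding) (σ y) (L.map σ.toEmbedding) = pairType x R y L := by
  simp [pairType, ← Finset.map_inter]

theorem exists_of_canGlue {b m₁ m₂ x y : ℕ} {R L : ℕ} (hx : x < 7) (hy : y < 7) (hb : b < 7)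
    (h : canGlue b m₁ m₂ x R y L = true) :
    ∃ (w : Fin 7) (S : Finset (Fin 7)), S.card = b ∧ w ∉ S ∧
      m₁.testBit (pairType ⟨x, hx⟩ (bitSet R) w S) = true ∧
      m₂.testBit (pairType w (insert w S)ᶜ ⟨y, hy⟩ (bitSet L)) = true := by
  simp only [canGlue, List.any_eq_true, Bool.and_eq_true, List.mem_range, beq_iff_eq] at h
  obtain ⟨S, hS, w, hw, h1, h2, h3⟩ := h
  obtain ⟨hS1, hS2⟩ := bitSets_spec ⟨b, hb⟩ S hS
  have hwS : (⟨w, hw⟩ : Fin 7) ∉ bitSet S := by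
    rw [mem_bitSet, Nat.testBit_eq_decide_div_mod_eq]
    have : Nat.shiftRight S w = S / 2 ^ w := Nat.shiftRight_eq_div_pow S w
    rw [this] at h2
    simp [h2]
  refine ⟨⟨w, hw⟩, bitSet S, by rw [card_bitSet, hS2], hwS, ?_, ?_⟩
  · rw [← bitType_eq]; exact h1
  · rw [← bitSet_compl ⟨S, hS1⟩ ⟨w, hw⟩ hwS, ← bitType_eq]; exact h3

/-- The colour and the left-hand colour set at a vertex where two pieces can be glued. -/
theorem exists_glue {k₁ k₂ k₃ : PieceKind} {a b c : ℕ} (ha : a < 7) (hb : b < 7) (hc : c < 7)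
    (h : glueCheck k₁ k₂ k₃ a b c = true) {m₁ m₂ : ℕ} (h₁ : m₁ ∈ k₁.types a b)
    (h₂ : m₂ ∈ k₂.types (6 - b) c) :
    ∃ m₃ ∈ k₃.types a c, ∀ (x y : Fin 7) (R L : Finset (Fin 7)), R.card = a → L.card = c →
      x ∉ R → y ∉ L → m₃.testBit (pairType x R y L) = true →
      ∃ (w : Fin 7) (S : Finset (Fin 7)), S.card = b ∧ w ∉ S ∧
        m₁.testBit (pairType x R w S) = true ∧
        m₂.testBit (pairType w (insert w S)ᶜ y L) = true := by
  simp only [glueCheck, List.all_eq_true, List.any_eq_true] at h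
  obtain ⟨m₃, h₃, h⟩ := h m₁ h₁ m₂ h₂
  refine ⟨m₃, h₃, fun x y R L hR hL hx hy ht => ?_⟩
  have hf := feasible_pairType hx hy
  have hlt := pairType_lt (y := y) (L := L) hx
  rw [hR, hL] at hf
  have hg := h (pairType x R y L) (by simpa using hlt)
  simp only [ht, hf, Bool.and_true, Bool.not_true, Bool.false_or] at hg
  obtain ⟨s1, s2, s3, s4, s5, s6⟩ := std_spec ⟨a, ha⟩ ⟨c, hc⟩ ⟨_, hlt⟩ hf
  dsimp only at s1 s2 s3 s4 s5 s6
  obtain ⟨w, S, hS, hwS, g1, g2⟩ := exists_of_canGlue (by norm_num) s5 hb hg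
  have e := bitType_eq ⟨0, by norm_num⟩ ⟨_, s5⟩ (stdR a (pairType x R y L))
    (stdL a c (pairType x R y L))
  rw [s6] at e
  -- The gluing colour and set found for the standard data are carried to the given data by `σ`.
  obtain ⟨σ, σx, σy, σR, σL⟩ := exists_perm_pair (x' := x) (y' := y) (R' := R) (L' := L)
    (x := ⟨0, by norm_num⟩) (y := ⟨_, s5⟩)
    (by rw [mem_bitSet]; simpa using s3) (by rw [mem_bitSet]; simpa using s4) hx hy
    (by rw [card_bitSet, s1, hR]) (by rw [card_bitSet, s2, hL]) e.symm
  have mapEq : ∀ {A B : Finset (Fin 7)}, (∀ i, σ i ∈ B ↔ i ∈ A) → A.map σ.toEmbedding = B := by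
    intro A B h
    ext i
    rw [Finset.mem_map_equiv, ← h, Equiv.apply_symm_apply]
  refine ⟨σ w, S.map σ.toEmbedding, by simpa using hS, by simpa using hwS, ?_, ?_⟩
  · rw [← σx, ← mapEq σR, pairType_perm]; exact g1
  · have : (insert (σ w) (S.map σ.toEmbedding))ᶜ = ((insert w S)ᶜ).map σ.toEmbedding := by
      ext i
      simp [Finset.mem_map_equiv]
    have e' := pairType_perm σ w ⟨_, s5⟩ (insert w S)ᶜ (bitSet (stdL a c (pairType x R y L)))
    rw [mapEq σL, σy] at e'
    rw [this, e']; exact g2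

/-- Removing the edge between the ends turns type `28 + k` into `7 + k`, whence the shift by 21. The
second half serves free pieces, where every type is available. -/
theorem closeCheck : ∀ a b : Fin 6, (1 ≤ (a : ℕ) ∧ 1 ≤ (b : ℕ) → ∀ m ∈ chainTypes a b,
      ∃ m' ∈ edgeTypes (a + 1) (b + 1), ∀ t < 35, m'.testBit t = true →
        28 ≤ t ∧ m.testBit (t - 21) = true) ∧
    ∃ m' ∈ edgeTypes (a + 1) (b + 1), ∀ t < 35, m'.testBit t = true → 28 ≤ t := by
  decide +kernel

/-! ### Gluing colourings of intervals and restoring an edge -/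

/-- No two edges cross when the vertices are placed on a circle in their natural order. -/
def Noncrossing (H : SimpleGraph ℕ) : Prop :=
  ∀ a b c d, a < b → b < c → c < d → H.Adj a c → ¬ H.Adj b d

/-- The square of `H` restricted to the interval from `u` to `v` has a colouring in which `u` and
`v` have the colours `x` and `y`, and their neighbours have colours in `R` and in `L`. -/
def IntervalColourable (H : SimpleGraph ℕ) (u v : ℕ) (x : Fin 7) (R : Finset (Fin 7)) (y : Fin 7)
    (L : Finset (Fin 7)) : Prop :=
  ∃ φ : ℕ → Fin 7, φ u = x ∧ φ v = y ∧ (∀ i, u < i → i ≤ v → H.Adj u i → φ i ∈ R) ∧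
    (∀ i, u ≤ i → i < v → H.Adj i v → φ i ∈ L) ∧
    (∀ i j, u ≤ i → i < j → j ≤ v → H.Adj i j → φ i ≠ φ j) ∧
    ∀ i j k, u ≤ i → i < j → j ≤ v → u ≤ k → k ≤ v → H.Adj i k → H.Adj k j → φ i ≠ φ j

/-- No edge jumps over `w`, so two vertices strictly on opposite sides can have only `w` as common
neighbour; their colours then lie in `S` and in its complement. -/
theorem IntervalColourable.glue {H : SimpleGraph ℕ} {u w v : ℕ} {x c y : Fin 7}
    {R S L : Finset (Fin 7)} (huw : u < w) (hwv : w < v)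
    (hcross : ∀ i j, u ≤ i → i < w → w < j → j ≤ v → ¬ H.Adj i j)
    (h₁ : IntervalColourable H u w x R c S)
    (h₂ : IntervalColourable H w v c (insert c S)ᶜ y L) :
    IntervalColourable H u v x R y L := by
  obtain ⟨φ, φu, φw, φR, φL, φa, φs⟩ := h₁
  obtain ⟨ψ, ψw, ψv, ψR, ψL, ψa, ψs⟩ := h₂
  set χ : ℕ → Fin 7 := fun i => if i ≤ w then φ i else ψ i with hχ
  have χ1 : ∀ i, i ≤ w → χ i = φ i := fun i hi => if_pos hi
  have χ2 : ∀ i, w ≤ i → χ i = ψ i := fun i hi => by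
    rcases hi.eq_or_lt with rfl | h
    · rw [χ1 _ le_rfl, φw, ψw]
    · exact if_neg (by omega)
  refine ⟨χ, by rw [χ1 _ huw.le, φu], by rw [χ2 _ hwv.le, ψv], ?_, ?_, ?_, ?_⟩
  · intro i hi hiv ha
    have : i ≤ w := by
      by_contra h
      exact hcross u i le_rfl huw (by omega) hiv ha
    rw [χ1 _ this]
    exact φR i hi this ha
  · intro i hi hiv ha
    have : w ≤ i := by
      by_contra h
      exact hcross i v hi (by omega) hwv le_rfl ha
    rw [χ2 _ this]
    exact ψL i this hiv ha
  · intro i j hi hij hj ha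
    rcases le_or_gt j w with h | h
    · rw [χ1 _ h, χ1 _ (by omega)]
      exact φa i j hi hij h ha
    · have : w ≤ i := by
        by_contra h'
        exact hcross i j hi (by omega) h hj ha
      rw [χ2 _ this, χ2 _ h.le]
      exact ψa i j this hij hj ha
  · intro i j k hi hij hj hk hkv h1 h2
    rcases le_or_gt j w with h | h
    · have hkw : k ≤ w := by
        by_contra h'
        exact hcross i k hi (by omega) (by omega) hkv h1
      rw [χ1 _ h, χ1 _ (by omega)]
      exact φs i j k hi hij h hk hkw h1 h2
    · have hwk : w ≤ k := by
        by_contra h'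
        exact hcross k j hk (by omega) h hj h2
      rcases le_or_gt w i with h' | h'
      · rw [χ2 _ h', χ2 _ h.le]
        exact ψs i j k h' hij hj hwk hkv h1 h2
      · have : k = w := by
          by_contra hne
          exact hcross i k hi h' (by omega) hkv h1
        subst this
        rw [χ1 _ h'.le, χ2 _ h.le]
        have e1 := φL i hi h' h1
        have e2 := ψR j h hj h2
        intro e
        rw [← e] at e2
        simp [e1] at e2

/-- The edge `uv` only adds conflicts of `u` with `v`, of `u` with neighbours of `v`, and of `v`
with neighbours of `u`. The last two are enforced in advance by the erasures. -/
theorem IntervalColourable.of_deleteEdge {H : SimpleGraph ℕ} {u v : ℕ} {x y : Fin 7}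
    {R L : Finset (Fin 7)} (huv : u < v) (hxy : x ≠ y) (hxL : x ∈ L) (hyR : y ∈ R)
    (h : IntervalColourable (H.deleteEdges {s(u, v)}) u v x (R.erase y) y (L.erase x)) :
    IntervalColourable H u v x R y L := by
  obtain ⟨φ, φu, φv, φR, φL, φa, φs⟩ := h
  have key : ∀ i j, i < j → H.Adj i j → ¬ (i = u ∧ j = v) →
      (H.deleteEdges {s(u, v)}).Adj i j := by
    intro i j hij ha hn
    rw [SimpleGraph.deleteEdges_adj]
    refine ⟨ha, ?_⟩
    simp only [Set.mem_singleton_iff, Sym2.eq_iff]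
    omega
  refine ⟨φ, φu, φv, ?_, ?_, ?_, ?_⟩
  · intro i hi hiv ha
    by_cases e : i = v
    · rw [e, φv]; exact hyR
    · exact Finset.mem_of_mem_erase (φR i hi hiv (key u i hi ha (by omega)))
  · intro i hi hiv ha
    by_cases e : i = u
    · rw [e, φu]; exact hxL
    · exact Finset.mem_of_mem_erase (φL i hi hiv (key i v hiv ha (by omega)))
  · intro i j hi hij hj ha
    by_cases e : i = u ∧ j = v
    · rw [e.1, e.2, φu, φv]; exact hxy
    · exact φa i j hi hij hj (key i j hij ha e)
  · intro i j k hi hij hj hk hkv h1 h2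
    have hik := h1.ne
    have hkj := h2.ne
    by_cases e1 : i = u ∧ k = v
    · obtain ⟨rfl, rfl⟩ := e1
      rw [φu]
      have := φL j (by omega) (by omega) (key j k (by omega) h2.symm (by omega))
      exact (Finset.ne_of_mem_erase this).symm
    by_cases e2 : k = u ∧ j = v
    · obtain ⟨rfl, rfl⟩ := e2
      rw [φv]
      have := φR i (by omega) (by omega) (key k i (by omega) h1.symm (by omega))
      exact Finset.ne_of_mem_erase this
    refine φs i j k hi hij hj hk hkv ?_ ?_
    · rcases lt_or_gt_of_ne hik with h | h
      · exact key i k h h1 e1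
      · exact (key k i h h1.symm (by omega)).symm
    · rcases lt_or_gt_of_ne hkj with h | h
      · exact key k j h h2 e2
      · exact (key j k h h2.symm (by omega)).symm

/-! ### The three kinds of pieces and the induction -/

section
open Classical

/-- Number of neighbours of `u` to its right, up to `v`. -/
noncomputable def rightDegree (H : SimpleGraph ℕ) (u v : ℕ) : ℕ :=
  ((Finset.Ioc u v).filter fun i => H.Adj u i).card

/-- Number of neighbours of `v` to its left, down to `u`. -/
noncomputable def leftDegree (H : SimpleGraph ℕ) (u v : ℕ) : ℕ :=
  ((Finset.Ico u v).filter fun i => H.Adj i v).card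

theorem rightDegree_mono {H K : SimpleGraph ℕ} (h : H ≤ K) (u v : ℕ) :
    rightDegree H u v ≤ rightDegree K u v :=
  Finset.card_le_card (Finset.monotone_filter_right _ fun _ _ ha => h ha)

theorem leftDegree_mono {H K : SimpleGraph ℕ} (h : H ≤ K) (u v : ℕ) :
    leftDegree H u v ≤ leftDegree K u v :=
  Finset.card_le_card (Finset.monotone_filter_right _ fun _ _ ha => h ha)

theorem leftDegree_pos {H : SimpleGraph ℕ} {u w v : ℕ} (huw : u ≤ w) (hwv : w < v)
    (h : H.Adj w v) : 1 ≤ leftDegree H u v :=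
  Finset.card_pos.2 ⟨w, by simp [huw, hwv, h]⟩

theorem rightDegree_deleteEdge {H : SimpleGraph ℕ} {u v : ℕ} (huv : u < v) (h : H.Adj u v) :
    rightDegree (H.deleteEdges {s(u, v)}) u v + 1 = rightDegree H u v := by
  have : rightDegree (H.deleteEdges {s(u, v)}) u v =
      (((Finset.Ioc u v).filter fun i => H.Adj u i).erase v).card := by
    unfold rightDegree
    congr 1
    ext i
    simp only [SimpleGraph.deleteEdges_adj, Finset.mem_filter, Finset.mem_Ioc, Finset.mem_erase,
      Set.mem_singleton_iff, Sym2.eq_iff, true_and]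
    constructor
    · rintro ⟨h1, h2, h3⟩; exact ⟨by omega, h1, h2⟩
    · rintro ⟨h1, h2, h3⟩; exact ⟨h2, h3, by omega⟩
  rw [this]
  exact Finset.card_erase_add_one (by simp [huv, h])

theorem leftDegree_deleteEdge {H : SimpleGraph ℕ} {u v : ℕ} (huv : u < v) (h : H.Adj u v) :
    leftDegree (H.deleteEdges {s(u, v)}) u v + 1 = leftDegree H u v := by
  have : leftDegree (H.deleteEdges {s(u, v)}) u v =
      (((Finset.Ico u v).filter fun i => H.Adj i v).erase u).card := by
    unfold leftDegree
    congr 1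
    ext i
    simp only [SimpleGraph.deleteEdges_adj, Finset.mem_filter, Finset.mem_Ico, Finset.mem_erase,
      Set.mem_singleton_iff, Sym2.eq_iff, and_true]
    constructor
    · rintro ⟨h1, h2, h3⟩; exact ⟨by omega, h1, h2⟩
    · rintro ⟨h1, h2, h3⟩; exact ⟨h2, h3, by omega⟩
  rw [this]
  exact Finset.card_erase_add_one (by simp [huv, h])

end

/-- The interval from `u` to `v` is colourable for all boundary data of the types guaranteed for
pieces of the kind `κ`. -/
def HasKind (H : SimpleGraph ℕ) (u v : ℕ) (κ : PieceKind) : Prop :=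
  (κ ≠ .free → 1 ≤ rightDegree H u v ∧ 1 ≤ leftDegree H u v) ∧
  ∀ a b, a < 7 → b < 7 → rightDegree H u v ≤ a → leftDegree H u v ≤ b →
    ∃ m ∈ κ.types a b, ∀ (x y : Fin 7) (R L : Finset (Fin 7)), R.card = a → L.card = b →
      x ∉ R → y ∉ L → m.testBit (pairType x R y L) = true → IntervalColourable H u v x R y L

theorem HasKind.gap {H : SimpleGraph ℕ} {u : ℕ} (h : ¬ H.Adj u (u + 1)) :
    HasKind H u (u + 1) .free := by
  refine ⟨fun h => absurd rfl h, fun a b _ _ _ _ => ⟨_, List.mem_singleton_self _, ?_⟩⟩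
  intro x y R L _ _ _ _ _
  refine ⟨fun i => if i = u then x else y, by simp, by simp, ?_, ?_, ?_, ?_⟩
  · intro i hi hiv ha
    obtain rfl : i = u + 1 := by omega
    exact absurd ha h
  · intro i hi hiv ha
    obtain rfl : i = u := by omega
    exact absurd ha h
  · intro i j hi hij hj ha
    obtain rfl : i = u := by omega
    obtain rfl : j = i + 1 := by omega
    exact absurd ha h
  · intro i j k hi hij hj hk hkv h1 h2
    have := h1.ne
    have := h2.ne
    omega

/-- The left piece receives exactly as many colours at `w` as `w` has left neighbours; the remaining
`6 - b` are enough on the right by the degree bound. -/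
theorem HasKind.glue {H : SimpleGraph ℕ} {u w v : ℕ} {k₁ k₂ k₃ : PieceKind} (huw : u < w)
    (hwv : w < v) (hcross : ∀ i j, u ≤ i → i < w → w < j → j ≤ v → ¬ H.Adj i j)
    (h₁ : HasKind H u w k₁) (h₂ : HasKind H w v k₂)
    (hdeg : leftDegree H u w + rightDegree H w v ≤ 6)
    (h₃ : k₃ ≠ .free → k₁ ≠ .free ∧ k₂ ≠ .free)
    (hcheck : ∀ a c, a < 7 → c < 7 → (k₁ ≠ .free → 1 ≤ a) → (k₂ ≠ .free → 1 ≤ c) →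
      glueCheck k₁ k₂ k₃ a (leftDegree H u w) c = true) :
    HasKind H u v k₃ := by
  have hr : rightDegree H u v = rightDegree H u w := by
    unfold rightDegree
    congr 1
    ext i
    simp only [Finset.mem_filter, Finset.mem_Ioc]
    constructor
    · rintro ⟨⟨h1, h2⟩, h3⟩
      refine ⟨⟨h1, ?_⟩, h3⟩
      by_contra h
      exact hcross u i le_rfl huw (by omega) h2 h3
    · rintro ⟨⟨h1, h2⟩, h3⟩
      exact ⟨⟨h1, by omega⟩, h3⟩
  have hl : leftDegree H u v = leftDegree H w v := by
    unfold leftDegree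
    congr 1
    ext i
    simp only [Finset.mem_filter, Finset.mem_Ico]
    constructor
    · rintro ⟨⟨h1, h2⟩, h3⟩
      refine ⟨⟨?_, h2⟩, h3⟩
      by_contra h
      exact hcross i v h1 (by omega) hwv le_rfl h3
    · rintro ⟨⟨h1, h2⟩, h3⟩
      exact ⟨⟨by omega, h2⟩, h3⟩
  refine ⟨fun h => ?_, fun a c ha hc hra hlc => ?_⟩
  · rw [hr, hl]
    exact ⟨(h₁.1 (h₃ h).1).1, (h₂.1 (h₃ h).2).2⟩
  rw [hr] at hra
  rw [hl] at hlc
  obtain ⟨m₁, hm₁, H₁⟩ := h₁.2 a (leftDegree H u w) ha (by omega) hra le_rfl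
  obtain ⟨m₂, hm₂, H₂⟩ := h₂.2 (6 - leftDegree H u w) c (by omega) hc (by omega) hlc
  obtain ⟨m₃, hm₃, H₃⟩ := exists_glue ha (by omega) hc
    (hcheck a c ha hc (fun h => (h₁.1 h).1.trans hra) fun h => (h₂.1 h).2.trans hlc) hm₁ hm₂
  refine ⟨m₃, hm₃, fun x y R L hR hL hx hy ht => ?_⟩
  obtain ⟨c', S, hS, hcS, t1, t2⟩ := H₃ x y R L hR hL hx hy ht
  refine IntervalColourable.glue huw hwv hcross (H₁ x c' R S hR hS hx hcS t1)
    (H₂ c' y _ L ?_ hL (by simp) hy t2)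
  rw [Finset.card_compl, Finset.card_insert_of_notMem hcS, hS, Fintype.card_fin]
  omega

theorem pairType_erase {x y : Fin 7} {R L : Finset (Fin 7)} (hx : x ∉ R) (hy : y ∉ L)
    (h : 28 ≤ pairType x R y L) : x ≠ y ∧ x ∈ L ∧ y ∈ R ∧
      pairType x (R.erase y) y (L.erase x) = pairType x R y L - 21 := by
  have h1 := Finset.card_le_card (Finset.inter_subset_left (s₁ := R) (s₂ := L))
  have h2 := Finset.card_lt_univ_of_notMem hx
  simp only [Fintype.card_fin] at h2
  have h3 : R.erase y ∩ L.erase x = R ∩ L := by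
    ext i
    simp only [Finset.mem_inter, Finset.mem_erase]
    constructor
    · tauto
    · rintro ⟨hR, hL⟩
      exact ⟨⟨by rintro rfl; exact hy hL, hR⟩, by rintro rfl; exact hx hR, hL⟩
  unfold pairType at h ⊢
  rw [h3]
  split_ifs at h ⊢ <;> simp_all <;> omega

theorem HasKind.addEdge {H : SimpleGraph ℕ} {u v : ℕ} {κ : PieceKind} (huv : u < v)
    (ha : H.Adj u v) (hκ : κ ≠ .edge) (h : HasKind (H.deleteEdges {s(u, v)}) u v κ) :
    HasKind H u v .edge := by
  have hr := rightDegree_deleteEdge huv ha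
  have hl := leftDegree_deleteEdge huv ha
  refine ⟨fun _ => by omega, fun a b ha hb hra hlb => ?_⟩
  obtain ⟨a, rfl⟩ : ∃ a', a = a' + 1 := ⟨a - 1, by omega⟩
  obtain ⟨b, rfl⟩ : ∃ b', b = b' + 1 := ⟨b - 1, by omega⟩
  obtain ⟨m, hm, hc⟩ := h.2 a b (by omega) (by omega) (by omega) (by omega)
  obtain ⟨m', hm', hc'⟩ : ∃ m' ∈ edgeTypes (a + 1) (b + 1), ∀ t < 35, m'.testBit t = true →
      28 ≤ t ∧ m.testBit (t - 21) = true := by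
    have check := closeCheck ⟨a, by omega⟩ ⟨b, by omega⟩
    match κ, hκ with
    | .chain, _ =>
      have := h.1 (by simp)
      exact check.1 ⟨by dsimp only; omega, by dsimp only; omega⟩ m hm
    | .free, _ =>
      obtain ⟨m', h1, h2⟩ := check.2
      refine ⟨m', h1, fun t ht h3 => ⟨h2 t ht h3, ?_⟩⟩
      rw [List.mem_singleton.1 hm, Nat.testBit_two_pow_sub_one]
      simp; omega
  refine ⟨m', hm', fun x y R L hR hL hx hy ht => ?_⟩
  obtain ⟨h1, h2⟩ := hc' _ (pairType_lt hx) ht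
  obtain ⟨hxy, hxL, hyR, e⟩ := pairType_erase hx hy h1
  refine IntervalColourable.of_deleteEdge huv hxy hxL hyR (hc x y _ _ ?_ ?_ ?_ ?_ (by rw [e]; exact h2))
  · rw [Finset.card_erase_of_mem hyR]; omega
  · rw [Finset.card_erase_of_mem hxL]; omega
  · simp [hx]
  · simp [hy]

/-- Every interval of a noncrossing graph of maximum degree at most six is a piece of one of the
three kinds. -/
theorem exists_hasKind (n : ℕ) : ∀ (H : SimpleGraph ℕ), Noncrossing H →
    (∀ u w v, leftDegree H u w + rightDegree H w v ≤ 6) → ∀ u v, v = u + 1 + n →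
    (H.Adj u v → HasKind H u v .edge) ∧
      (¬ H.Adj u v → HasKind H u v .chain ∨ HasKind H u v .free) := by
  induction n using Nat.strong_induction_on with
  | _ n ih =>
    -- Proved for all `H` at this length, because the adjacent case applies it to the same interval
    -- with `uv` deleted.
    have nonadj : ∀ (H : SimpleGraph ℕ), Noncrossing H →
        (∀ u w v, leftDegree H u w + rightDegree H w v ≤ 6) → ∀ u v, v = u + 1 + n →
        ¬ H.Adj u v → HasKind H u v .chain ∨ HasKind H u v .free := by
      intro H hH hdeg u v huv hna
      have any : ∀ w, u < w → w < v → HasKind H w v .edge ∨ HasKind H w v .chain ∨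
          HasKind H w v .free := by
        intro w huw hwv
        have := ih (v - w - 1) (by omega) H hH hdeg w v (by omega)
        by_cases h : H.Adj w v
        · exact Or.inl (this.1 h)
        · exact Or.inr (this.2 h)
      by_cases hex : ∃ w, u < w ∧ w < v ∧ H.Adj u w
      · obtain ⟨w, ⟨huw, hwv, hadj⟩, hmax⟩ : ∃ w, (u < w ∧ w < v ∧ H.Adj u w) ∧
            ∀ j, w < j → j ≤ v → ¬ H.Adj u j := by
          classical
          obtain ⟨w₀, h₀⟩ := hex
          have hs := Nat.findGreatest_spec (P := fun w => u < w ∧ w < v ∧ H.Adj u w) h₀.2.1.le h₀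
          refine ⟨_, hs, fun j hj hjv ha => ?_⟩
          rcases hjv.eq_or_lt with rfl | hlt
          · exact hna ha
          · exact Nat.findGreatest_is_greatest hj hjv ⟨hs.1.trans hj, hlt, ha⟩
        have hcross : ∀ i j, u ≤ i → i < w → w < j → j ≤ v → ¬ H.Adj i j := by
          intro i j hi hiw hwj hj ha
          rcases hi.eq_or_lt with rfl | hlt
          · exact hmax j hwj hj ha
          · exact hH u i w j hlt hiw hwj hadj ha
        have hE := (ih (w - u - 1) (by omega) H hH hdeg u w (by omega)).1 hadj
        have hd := hdeg u w v
        have hb : 1 ≤ leftDegree H u w := leftDegree_pos le_rfl huw hadj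
        rcases any w huw hwv with h2 | h2 | h2
        · left
          have hb' := (h2.1 (by simp)).1
          exact hE.glue huw hwv hcross h2 hd (by simp) fun a c ha hc h1 h3 => by
            obtain ⟨a, rfl⟩ := Nat.exists_eq_add_of_le' (h1 (by simp))
            obtain ⟨c, rfl⟩ := Nat.exists_eq_add_of_le' (h3 (by simp))
            obtain ⟨b, hb⟩ := Nat.exists_eq_add_of_le' hb
            rw [hb]
            exact (glueCheck_edge ⟨a, by omega⟩ ⟨b, by omega⟩ ⟨c, by omega⟩).1
        · left
          have hb' := (h2.1 (by simp)).1
          exact hE.glue huw hwv hcross h2 hd (by simp) fun a c ha hc h1 h3 => by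
            obtain ⟨a, rfl⟩ := Nat.exists_eq_add_of_le' (h1 (by simp))
            obtain ⟨c, rfl⟩ := Nat.exists_eq_add_of_le' (h3 (by simp))
            obtain ⟨b, hb⟩ := Nat.exists_eq_add_of_le' hb
            rw [hb]
            exact (glueCheck_edge ⟨a, by omega⟩ ⟨b, by omega⟩ ⟨c, by omega⟩).2
        · right
          exact hE.glue huw hwv hcross h2 hd (by simp) fun a c ha hc h1 _ => by
            obtain ⟨a, rfl⟩ := Nat.exists_eq_add_of_le' (h1 (by simp))
            obtain ⟨b, hb⟩ := Nat.exists_eq_add_of_le' hb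
            rw [hb]
            exact glueCheck_edge_free ⟨a, by omega⟩ ⟨b, by omega⟩ ⟨c, hc⟩
      · push Not at hex
        right
        have hna' : ∀ j, u < j → j ≤ v → ¬ H.Adj u j := by
          intro j hj hjv
          rcases hjv.eq_or_lt with rfl | hlt
          · exact hna
          · exact hex j hj hlt
        have hgap := HasKind.gap (hna' (u + 1) (by omega) (by omega))
        rcases Nat.eq_zero_or_pos n with rfl | hn
        · exact huv ▸ hgap
        have hcross : ∀ i j, u ≤ i → i < u + 1 → u + 1 < j → j ≤ v → ¬ H.Adj i j := by
          intro i j hi hiw hwj hj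
          obtain rfl : i = u := by omega
          exact hna' j (by omega) hj
        have hb : leftDegree H u (u + 1) = 0 := by
          classical
          rw [leftDegree, Finset.card_eq_zero, Finset.filter_eq_empty_iff]
          intro i hi
          obtain rfl : i = u := by simp at hi; omega
          exact hna' _ (by omega) (by omega)
        have hd := hdeg u (u + 1) v
        rcases any (u + 1) (by omega) (by omega) with h2 | h2 | h2
        · exact hgap.glue (by omega) (by omega) hcross h2 hd (by simp) fun a c ha hc _ h3 => by
            obtain ⟨c, rfl⟩ := Nat.exists_eq_add_of_le' (h3 (by simp))
            rw [hb]
            exact (glueCheck_free_left ⟨a, ha⟩ ⟨c, by omega⟩).1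
        · exact hgap.glue (by omega) (by omega) hcross h2 hd (by simp) fun a c ha hc _ h3 => by
            obtain ⟨c, rfl⟩ := Nat.exists_eq_add_of_le' (h3 (by simp))
            rw [hb]
            exact (glueCheck_free_left ⟨a, ha⟩ ⟨c, by omega⟩).2
        · exact hgap.glue (by omega) (by omega) hcross h2 hd (by simp) fun a c ha hc _ _ =>
            hb ▸ glueCheck_free ⟨a, ha⟩ ⟨c, hc⟩
    intro H hH hdeg u v huv
    refine ⟨fun ha => ?_, nonadj H hH hdeg u v huv⟩
    have hle : H.deleteEdges {s(u, v)} ≤ H := SimpleGraph.deleteEdges_le _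
    have := nonadj (H.deleteEdges {s(u, v)})
      (fun a b c d h1 h2 h3 h4 h5 => hH a b c d h1 h2 h3 (hle h4) (hle h5))
      (fun u w v => (Nat.add_le_add (leftDegree_mono hle u w) (rightDegree_mono hle w v)).trans
        (hdeg u w v)) u v huv (by simp [SimpleGraph.deleteEdges_adj])
    rcases this with h | h
    · exact h.addEdge (by omega) ha (by simp)
    · exact h.addEdge (by omega) ha (by simp)

/-- The unrestrictive data, each end permitting all colours but its own, have type `33 = 28 + 5`,
which every kind contains. -/
theorem exists_pairType_mem : ∀ m : ℕ, m ∈ edgeTypes 6 6 ∨ m ∈ chainTypes 6 6 ∨ m = 2 ^ 35 - 1 →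
    m.testBit (pairType 0 {0}ᶜ 1 {1}ᶜ) = true := by
  have h : pairType 0 {0}ᶜ 1 {1}ᶜ = 33 := by decide
  rw [h]
  rintro m (hm | hm | rfl)
  · revert m; decide
  · revert m; decide
  · decide

/-- The square of a noncrossing graph of maximum degree at most six is 7-colourable. -/
theorem exists_square_colouring {H : SimpleGraph ℕ} (hH : Noncrossing H)
    (hdeg : ∀ u w v, leftDegree H u w + rightDegree H w v ≤ 6) (n : ℕ) :
    ∃ φ : ℕ → Fin 7, ∀ i j, i < j → j ≤ n + 1 → (H.Adj i j ∨ ∃ k ≤ n + 1, H.Adj i k ∧ H.Adj k j) →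
      φ i ≠ φ j := by
  have hr : rightDegree H 0 (n + 1) ≤ 6 := by have := hdeg 0 0 (n + 1); omega
  have hl : leftDegree H 0 (n + 1) ≤ 6 := by have := hdeg 0 (n + 1) (n + 1); omega
  have h := exists_hasKind n H hH hdeg 0 (n + 1) (by omega)
  obtain ⟨κ, hκ⟩ : ∃ κ, HasKind H 0 (n + 1) κ := by
    by_cases ha : H.Adj 0 (n + 1)
    · exact ⟨_, h.1 ha⟩
    · rcases h.2 ha with h | h <;> exact ⟨_, h⟩
  obtain ⟨m, hm, hc⟩ := hκ.2 6 6 (by omega) (by omega) hr hl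
  obtain ⟨φ, -, -, -, -, h1, h2⟩ := hc 0 1 {0}ᶜ {1}ᶜ rfl rfl (by simp) (by simp)
    (exists_pairType_mem m (by
      match κ with
      | .edge => exact Or.inl hm
      | .chain => exact Or.inr (Or.inl hm)
      | .free => exact Or.inr (Or.inr (List.mem_singleton.1 hm))))
  refine ⟨φ, fun i j hij hj hadj => ?_⟩
  rcases hadj with ha | ⟨k, hk, ha, hb⟩
  · exact h1 i j (by omega) hij hj ha
  · exact h2 i j k (by omega) hij hj (by omega) hk ha hb

/-! ### From the drawing to a noncrossing order -/

/-- The vertices of an outerplanar graph can be placed on a line so that no two edges cross. -/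
theorem IsOuterplanar.exists_noncrossing {V : Type u} {G : SimpleGraph V} (hG : IsOuterplanar G) :
    ∃ f : V → ℝ, Function.Injective f ∧ ∀ a b c d, f a < f b → f b < f c → f c < f d →
      G.Adj a c → ¬ G.Adj b d := by
  obtain ⟨p, A, h⟩ := hG
  have hp : ∀ v, ‖p v‖ = 1 := fun v => by simpa using h.on_circle v
  have hexp : ∀ v, p v = Complex.exp (Complex.arg (p v) * Complex.I) := fun v => by
    have := Complex.norm_mul_exp_arg_mul_I (p v)
    rw [hp, Complex.ofReal_one, one_mul] at this
    exact this.symm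
  -- The principal argument cuts the circle open at -1. Interlaced edges would meet, yet they share
  -- no end.
  refine ⟨fun v => Complex.arg (p v), fun v w hvw => h.injective ?_, ?_⟩
  · rw [hexp v, hexp w]
    simp only at hvw
    rw [hvw]
  intro a b c d hab hbc hcd hac hbd
  obtain ⟨γ, -, hγ⟩ := h.arc a c hac
  obtain ⟨η, -, hη⟩ := h.arc b d hbd
  have hγ1 : ∀ t, ‖γ t‖ ≤ 1 := fun t => by
    simpa using h.in_disc s(a, c) hac (hγ ▸ Set.mem_range_self t)
  have hη1 : ∀ t, ‖η t‖ ≤ 1 := fun t => by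
    simpa using h.in_disc s(b, d) hbd (hη ▸ Set.mem_range_self t)
  obtain ⟨s, t, hst⟩ := exists_eq_of_interlaced hab hbc hcd
    (by linarith [Complex.arg_le_pi (p d), Complex.neg_pi_lt_arg (p a)])
    (γ.cast (hexp a).symm (hexp c).symm) (η.cast (hexp b).symm (hexp d).symm) hγ1 hη1
  have ne : ∀ {v w}, Complex.arg (p v) < Complex.arg (p w) → v ≠ w := by
    rintro v _ hvw rfl
    exact lt_irrefl _ hvw
  have h1 : γ s ∈ A s(a, c) ∩ A s(b, d) :=
    ⟨hγ ▸ Set.mem_range_self s, (show γ s = η t from hst) ▸ hη ▸ Set.mem_range_self t⟩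
  have hab' := ne hab
  have hbc' := ne hbc
  have hcd' := ne hcd
  have had' := ne (hab.trans (hbc.trans hcd))
  obtain ⟨v, ⟨hv1, hv2⟩, -⟩ := h.edge_inter s(a, c) hac s(b, d) hbd (by
    simp only [ne_eq, Sym2.eq_iff]
    tauto) h1
  rw [Sym2.mem_iff] at hv1 hv2
  rcases hv1 with rfl | rfl <;> rcases hv2 with rfl | rfl <;> contradiction

/-- Each vertex is replaced by its rank in the linear order. -/
theorem exists_noncrossing_embedding {V : Type u} [Fintype V] {G : SimpleGraph V}
    (hG : IsOuterplanar G) :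
    ∃ g : V ↪ ℕ, (∀ v, g v < Fintype.card V) ∧ Noncrossing (G.map g) := by
  classical
  obtain ⟨f, hf, hG⟩ := hG.exists_noncrossing
  let g : V → ℕ := fun v => (Finset.univ.filter fun w => f w < f v).card
  have lt_of : ∀ {v w}, f v < f w → g v < g w := fun {v w} h =>
    Finset.card_lt_card ⟨fun i hi => by simp at hi ⊢; linarith, fun h' => by
      have : v ∈ Finset.univ.filter fun w => f w < f v := h' (by simpa using h)
      simp at this⟩
  have lt_iff : ∀ {v w}, g v < g w → f v < f w := fun {v w} h => by
    rcases lt_trichotomy (f v) (f w) with h' | h' | h'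
    · exact h'
    · rw [hf h'] at h; exact absurd h (lt_irrefl _)
    · exact absurd h (lt_of h').not_gt
  have hg : Function.Injective g := fun v w h => by
    by_contra hne
    rcases lt_or_gt_of_ne (hf.ne hne) with h' | h'
    · exact (lt_of h').ne h
    · exact (lt_of h').ne' h
  refine ⟨⟨g, hg⟩, fun v => ?_, ?_⟩
  · exact Finset.card_lt_univ_of_notMem (x := v) (by simp)
  · intro _ _ _ _ h1 h2 h3 h4 h5
    rw [SimpleGraph.map_adj] at h4 h5
    obtain ⟨a, c, hac, rfl, rfl⟩ := h4
    obtain ⟨b, d, hbd, rfl, rfl⟩ := h5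
    exact hG a b c d (lt_iff h1) (lt_iff h2) (lt_iff h3) hac hbd

theorem leftDegree_add_rightDegree_map_le {V : Type u} [Fintype V] (G : SimpleGraph V)
    [DecidableRel G.Adj] (g : V ↪ ℕ) (u w v : ℕ) :
    leftDegree (G.map g) u w + rightDegree (G.map g) w v ≤ G.maxDegree := by
  classical
  obtain ⟨H, hH⟩ : ∃ H, H = G.map g := ⟨_, rfl⟩
  rw [← hH, leftDegree, rightDegree, ← Finset.card_union_of_disjoint (by
    rw [Finset.disjoint_left]
    intro i hi hi'
    simp only [Finset.mem_filter, Finset.mem_Ico, Finset.mem_Ioc] at hi hi'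
    omega)]
  by_cases hw : ∃ x, g x = w
  · obtain ⟨x, rfl⟩ := hw
    refine le_trans (Finset.card_le_card (t := (G.neighborFinset x).image g) ?_)
      (Finset.card_image_le.trans (G.degree_le_maxDegree x))
    intro i hi
    have : H.Adj (g x) i := by
      rcases Finset.mem_union.1 hi with h | h
      · exact (Finset.mem_filter.1 h).2.symm
      · exact (Finset.mem_filter.1 h).2
    rw [hH, SimpleGraph.map_adj] at this
    obtain ⟨y, z, hyz, hy, rfl⟩ := this
    obtain rfl := g.injective hy
    exact Finset.mem_image_of_mem _ (by simpa using hyz)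
  · rw [Finset.card_eq_zero.2]
    · exact Nat.zero_le _
    rw [Finset.eq_empty_iff_forall_notMem]
    intro i hi
    have : H.Adj w i := by
      rcases Finset.mem_union.1 hi with h | h
      · exact (Finset.mem_filter.1 h).2.symm
      · exact (Finset.mem_filter.1 h).2
    rw [hH, SimpleGraph.map_adj] at this
    obtain ⟨y, z, hyz, hy, rfl⟩ := this
    exact hw ⟨y, hy⟩

/-! ### The chromatic number of the square -/

theorem IsOuterplanar.squareGraph_colorable {V : Type u} [Fintype V] {G : SimpleGraph V}
    [DecidableRel G.Adj] (hG : IsOuterplanar G) (hΔ : G.maxDegree ≤ 6) :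
    (squareGraph G).Colorable 7 := by
  obtain ⟨g, hg, hnc⟩ := exists_noncrossing_embedding hG
  obtain ⟨φ, hφ⟩ := exists_square_colouring hnc
    (fun u w v => (leftDegree_add_rightDegree_map_le G g u w v).trans hΔ) (Fintype.card V)
  have key : ∀ v w, g v < g w → (squareGraph G).Adj v w → φ (g v) ≠ φ (g w) := by
    rintro v w hlt ⟨-, h⟩
    refine hφ _ _ hlt (by have := hg w; omega) ?_
    rcases h with h | ⟨x, h1, h2⟩
    · exact Or.inl (SimpleGraph.map_adj_apply.2 h)
    · exact Or.inr ⟨g x, by have := hg x; omega, SimpleGraph.map_adj_apply.2 h1,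
        SimpleGraph.map_adj_apply.2 h2⟩
  refine ⟨SimpleGraph.Coloring.mk (fun v => φ (g v)) fun {v w} h => ?_⟩
  rcases lt_or_gt_of_ne (g.injective.ne h.ne) with hlt | hlt
  · exact key v w hlt h
  · exact (key w v hlt h.symm).symm

theorem maxDegree_lt_chromaticNumber_squareGraph {V : Type u} [Fintype V] [Nonempty V]
    (G : SimpleGraph V) [DecidableRel G.Adj] :
    ((G.maxDegree + 1 : ℕ) : ℕ∞) ≤ (squareGraph G).chromaticNumber := by
  classical
  obtain ⟨v, hv⟩ := G.exists_maximal_degree_vertex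
  have hc : (squareGraph G).IsClique (insert v (G.neighborFinset v) : Finset V) := by
    intro a ha b hb hab
    refine ⟨hab, ?_⟩
    simp only [Finset.coe_insert, Set.mem_insert_iff, Finset.mem_coe,
      SimpleGraph.mem_neighborFinset] at ha hb
    rcases ha with rfl | ha <;> rcases hb with rfl | hb
    · exact absurd rfl hab
    · exact Or.inl hb
    · exact Or.inl ha.symm
    · exact Or.inr ⟨v, ha.symm, hb⟩
  have := hc.card_le_chromaticNumber
  rwa [Finset.card_insert_of_notMem (by simp), SimpleGraph.card_neighborFinset_eq_degree,
    ← hv] at this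

theorem IsOuterplanar.chromaticNumber_squareGraph {V : Type u} [Fintype V] {G : SimpleGraph V}
    [DecidableRel G.Adj] (hG : IsOuterplanar G) (hΔ : G.maxDegree = 6) :
    (squareGraph G).chromaticNumber = 7 := by
  have : Nonempty V := by
    by_contra h
    rw [not_nonempty_iff] at h
    simp [SimpleGraph.maxDegree] at hΔ
  refine le_antisymm (hG.squareGraph_colorable hΔ.le).chromaticNumber_le ?_
  have := maxDegree_lt_chromaticNumber_squareGraph G
  rw [hΔ] at this
  exact this

theorem mainTheorem3 {V : Type u} [Fintype V] (G : SimpleGraph V) [DecidableRel G.Adj] :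
    ¬ IsMinimalCriminal G ∧
    (IsBiconnected G → IsOuterplanar G → G.maxDegree = 6 →
      (squareGraph G).chromaticNumber = 7) ∧
    (IsOuterplanar G → G.maxDegree = 6 →
      (squareGraph G).chromaticNumber = 7) := by
  refine ⟨?_, fun _ h hΔ => h.chromaticNumber_squareGraph hΔ,
    fun h hΔ => h.chromaticNumber_squareGraph hΔ⟩
  rintro ⟨⟨-, h, hΔ, h8⟩, -⟩
  rw [h.chromaticNumber_squareGraph hΔ] at h8
  exact absurd h8 (by decide)
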